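/- For a field $k$ let $\mathfrak C_k$ be the split octonion algebra over $k$, i.e. the $8$-dimensional $k$-algebra of arrays $\begin{pmatrix}\alpha & v\\ w&\beta\end{pmatrix}$ with $\alpha,\beta\in k$ and $v,w\in k^3$, with entrywise addition and the product $$\begin{pmatrix}\alpha & v\\ w&\beta\end{pmatrix}\begin{pmatrix}\alpha' & v'\\ w'&\beta'\end{pmatrix}=\begin{pmatrix}\alpha\alpha'-\langle v,w'\rangle & \alpha v'+\beta' v+w\times w'\\ \beta w'+\alpha' w+v\times v'&\beta\beta'-\langle w,v'\rangle\end{pmatrix},$$ where $\langle\cdot,\cdot\rangle$ is the standard dot product and $\times$ the cross product on $k^3$. Let $G_2(k)=\operatorname{Aut}_{k\text{-alg}}(\mathfrak C_k)$ be the group of $k$-points of the split group of type $G_2$. An element of $G_2(k)$ is called semisimple if, as a linear map of $\mathfrak C_k$, it is diagonalizable over an algebraic closure of $k$. Theorem. Let $k=\mathbb Q$, or $k=\mathbb Q_p$ for any prime $p$. Then there exists a semisimple element $g\in G_2(k)$ which is not conjugate to $g^{-1}$ in $G_2(k)$. -/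

import Mathlib

open scoped Matrix

/-- The matrix model of the split octonion algebra over a commutative ring `R`: an element is an
array `(α, v; w, β)` with `α, β ∈ R` and `v, w ∈ R³`. -/
@[ext]
structure SplitOctonion (R : Type*) where
  /-- upper left entry -/
  α : R
  /-- upper right entry -/
  v : Fin 3 → R
  /-- lower left entry -/
  w : Fin 3 → R
  /-- lower right entry -/
  β : R

namespace SplitOctonion

variable {R : Type*} [CommRing R]

instance : Zero (SplitOctonion R) := ⟨⟨0, 0, 0, 0⟩⟩
instance : One (SplitOctonion R) := ⟨⟨1, 0, 0, 1⟩⟩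
instance : Add (SplitOctonion R) := ⟨fun x y => ⟨x.α + y.α, x.v + y.v, x.w + y.w, x.β + y.β⟩⟩
instance : Neg (SplitOctonion R) := ⟨fun x => ⟨-x.α, -x.v, -x.w, -x.β⟩⟩
instance : SMul R (SplitOctonion R) := ⟨fun c x => ⟨c * x.α, c • x.v, c • x.w, c * x.β⟩⟩

/-- The octonion product; `⬝ᵥ` is the standard dot product and `⨯₃` the cross product of `R³`. -/
instance : Mul (SplitOctonion R) :=
  ⟨fun x y =>
    ⟨x.α * y.α - x.v ⬝ᵥ y.w,
     x.α • y.v + y.β • x.v + x.w ⨯₃ y.w,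
     x.β • y.w + y.α • x.w + x.v ⨯₃ y.v,
     x.β * y.β - x.w ⬝ᵥ y.v⟩⟩

@[simp] lemma zero_α : (0 : SplitOctonion R).α = 0 := rfl
@[simp] lemma zero_v : (0 : SplitOctonion R).v = 0 := rfl
@[simp] lemma zero_w : (0 : SplitOctonion R).w = 0 := rfl
@[simp] lemma zero_β : (0 : SplitOctonion R).β = 0 := rfl
@[simp] lemma one_α : (1 : SplitOctonion R).α = 1 := rfl
@[simp] lemma one_v : (1 : SplitOctonion R).v = 0 := rfl
@[simp] lemma one_w : (1 : SplitOctonion R).w = 0 := rfl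
@[simp] lemma one_β : (1 : SplitOctonion R).β = 1 := rfl
@[simp] lemma add_α (x y : SplitOctonion R) : (x + y).α = x.α + y.α := rfl
@[simp] lemma add_v (x y : SplitOctonion R) : (x + y).v = x.v + y.v := rfl
@[simp] lemma add_w (x y : SplitOctonion R) : (x + y).w = x.w + y.w := rfl
@[simp] lemma add_β (x y : SplitOctonion R) : (x + y).β = x.β + y.β := rfl
@[simp] lemma neg_α (x : SplitOctonion R) : (-x).α = -x.α := rfl
@[simp] lemma neg_v (x : SplitOctonion R) : (-x).v = -x.v := rfl
@[simp] lemma neg_w (x : SplitOctonion R) : (-x).w = -x.w := rfl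
@[simp] lemma neg_β (x : SplitOctonion R) : (-x).β = -x.β := rfl
@[simp] lemma smul_α (c : R) (x : SplitOctonion R) : (c • x).α = c * x.α := rfl
@[simp] lemma smul_v (c : R) (x : SplitOctonion R) : (c • x).v = c • x.v := rfl
@[simp] lemma smul_w (c : R) (x : SplitOctonion R) : (c • x).w = c • x.w := rfl
@[simp] lemma smul_β (c : R) (x : SplitOctonion R) : (c • x).β = c * x.β := rfl
@[simp] lemma mul_α (x y : SplitOctonion R) : (x * y).α = x.α * y.α - x.v ⬝ᵥ y.w := rfl
@[simp] lemma mul_v (x y : SplitOctonion R) :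
    (x * y).v = x.α • y.v + y.β • x.v + x.w ⨯₃ y.w := rfl
@[simp] lemma mul_w (x y : SplitOctonion R) :
    (x * y).w = x.β • y.w + y.α • x.w + x.v ⨯₃ y.v := rfl
@[simp] lemma mul_β (x y : SplitOctonion R) : (x * y).β = x.β * y.β - x.w ⬝ᵥ y.v := rfl

instance : AddCommGroup (SplitOctonion R) where
  add_assoc x y z := by ext <;> simp [add_assoc]
  zero_add x := by ext <;> simp
  add_zero x := by ext <;> simp
  neg_add_cancel x := by ext <;> simp
  add_comm x y := by ext <;> simp [add_comm]
  nsmul := nsmulRec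
  zsmul := zsmulRec

instance : Module R (SplitOctonion R) where
  one_smul x := by ext <;> simp
  mul_smul c d x := by ext <;> simp [mul_assoc]
  smul_zero c := by ext <;> simp
  smul_add c x y := by ext <;> simp [mul_add]
  add_smul c d x := by ext <;> simp [add_mul]
  zero_smul x := by ext <;> simp

instance : NonAssocRing (SplitOctonion R) where
  left_distrib x y z := by
    ext i <;> simp <;> ring
  right_distrib x y z := by
    ext i <;> simp <;> ring
  zero_mul x := by ext <;> simp
  mul_zero x := by ext <;> simp
  one_mul x := by ext <;> simp
  mul_one x := by ext <;> simp

instance : IsScalarTower R (SplitOctonion R) (SplitOctonion R) where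
  smul_assoc c x y := by
    ext i <;> simp <;> ring

instance : SMulCommClass R (SplitOctonion R) (SplitOctonion R) where
  smul_comm c x y := by
    ext i <;> simp <;> ring

/-- The octonion norm `N(x) = αβ + ⟨v, w⟩`. -/
def norm (x : SplitOctonion R) : R := x.α * x.β + x.v ⬝ᵥ x.w

/-- The norm permits composition. -/
theorem norm_mul (x y : SplitOctonion R) : norm (x * y) = norm x * norm y := by
  simp [norm, cross_apply, dotProduct, Fin.sum_univ_three]
  ring

end SplitOctonion

/-- The group of `R`-points of the split algebraic group of type `G₂`: the group of all
`R`-algebra automorphisms (multiplicative `R`-linear bijections) of the split octonion algebra. -/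
def SplitG2 (R : Type*) [CommRing R] : Subgroup (SplitOctonion R ≃ₗ[R] SplitOctonion R) where
  carrier := {g | ∀ x y : SplitOctonion R, g (x * y) = g x * g y}
  one_mem' := fun _ _ => rfl
  mul_mem' := by
    intro g h hg hh x y
    change g (h (x * y)) = g (h x) * g (h y)
    rw [hh, hg]
  inv_mem' := by
    intro g hg x y
    change g.symm (x * y) = g.symm x * g.symm y
    rw [LinearEquiv.symm_apply_eq, hg, LinearEquiv.apply_symm_apply, LinearEquiv.apply_symm_apply]

/-- An element of `G₂(k)` is semisimple if its action on the (8-dimensional, faithful) octonion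
representation is diagonalizable over an algebraic closure of `k`, i.e. if its minimal polynomial
over `k` has no repeated root in an algebraic closure. -/
def SplitG2.IsSemisimple {k : Type*} [Field k] (g : SplitG2 k) : Prop :=
  (minpoly k ((g : SplitOctonion k ≃ₗ[k] SplitOctonion k) :
    Module.End k (SplitOctonion k))).Separable

/-- An element of a group is real if it is conjugate in the group to its inverse. -/
def IsRealElement {G : Type*} [Group G] (g : G) : Prop := IsConj g g⁻¹

/-! Let `M` in SL₃(k) have irreducible characteristic polynomial f = X³ - aX² + bX - 1, and let it
act on the octonions by `ofMatrix`. As 1 is not an eigenvalue of `M`, the fixed octonions are the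
diagonal ones, so an automorphism conjugating this element to its inverse fixes or swaps the two
diagonal idempotents (`exists_matrix_of_isRealElement`). If it fixes them, `M` is conjugate to its
inverse and a = b, which is excluded by f(1) = b - a ≠ 0. If it swaps them, there is `B` of
determinant 1 with `B * M = Mᵀ * B`.

Such `B` form a line over the cubic field K = k[X]/(f). For `M` the companion matrix conjugated by
diag(d, 1, 1), -d² det `B` is a norm from K (`twistedCompanion_not_real`), so it suffices that -d²
is not a norm. Over ℚ_p, choose f irreducible mod p: K is unramified, norms have valuation divisible
by 3, and d = p works (`padic_cubicNormForm_ne`). Both conditions on f and d descend to subfields,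
and ℚ embeds in ℚ_2. -/

open Polynomial

/-! ### Norm forms of cubic algebras -/

section NormForm

variable {R : Type*} [CommRing R]

/-- The cubic polynomial `X³ - aX² + bX - 1`. -/
noncomputable def unimodularCubic (a b : R) : R[X] := X ^ 3 - C a * X ^ 2 + C b * X - 1

/-- The norm of `x + yt + zt²` in the cubic algebra `R[t]/(t³ - at² + bt - 1)`. -/
def cubicNormForm (a b x y z : R) : R :=
  !![x, z, y + a * z;
     y, x - b * z, z - b * (y + a * z);
     z, y + a * z, x - b * z + a * (y + a * z)].det

lemma cubicNormForm_smul (a b t x y z : R) :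
    cubicNormForm a b (t * x) (t * y) (t * z) = t ^ 3 * cubicNormForm a b x y z := by
  simp [cubicNormForm, Matrix.det_fin_three]; ring

lemma cubicNormForm_map {S : Type*} [CommRing S] (φ : R →+* S) (a b x y z : R) :
    φ (cubicNormForm a b x y z) = cubicNormForm (φ a) (φ b) (φ x) (φ y) (φ z) := by
  simp [cubicNormForm, Matrix.det_fin_three]

lemma cubicNormForm_linear (a b r : R) :
    cubicNormForm a b (-r) 1 0 = -(unimodularCubic a b).eval r := by
  simp [cubicNormForm, Matrix.det_fin_three, unimodularCubic]; ring

lemma unimodularCubic_monic [Nontrivial R] (a b : R) : (unimodularCubic a b).Monic := by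
  unfold unimodularCubic; monicity!

lemma unimodularCubic_natDegree [Nontrivial R] (a b : R) :
    (unimodularCubic a b).natDegree = 3 := by
  unfold unimodularCubic; compute_degree!

lemma unimodularCubic_irreducible {K : Type*} [Field K] {a b : K}
    (h : ∀ r, (unimodularCubic a b).eval r ≠ 0) : Irreducible (unimodularCubic a b) := by
  refine (Polynomial.irreducible_iff_roots_eq_zero_of_degree_le_three ?_ ?_).2 ?_
  · rw [unimodularCubic_natDegree]; norm_num
  · rw [unimodularCubic_natDegree]
  · refine Multiset.eq_zero_of_forall_notMem fun r hr => h r ?_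
    exact (mem_roots'.1 hr).2

lemma aeval_unimodularCubic_companion (a b : R) :
    aeval (!![0, 0, 1; 1, 0, -b; 0, 1, a] : Matrix (Fin 3) (Fin 3) R) (unimodularCubic a b) = 0 := by
  ext i j
  fin_cases i <;> fin_cases j <;>
    simp [unimodularCubic, pow_succ, Matrix.mul_apply,
      Matrix.algebraMap_matrix_apply] <;> ring

/-- Identifies the matrix behind `cubicNormForm` with a polynomial in the companion matrix, so that
identities in `K[X]` can be evaluated there. -/
lemma aeval_quadratic_companion (a b x y z : R) :
    aeval (!![0, 0, 1; 1, 0, -b; 0, 1, a] : Matrix (Fin 3) (Fin 3) R)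
      (C x + C y * X + C z * X ^ 2) =
    !![x, z, y + a * z;
     y, x - b * z, z - b * (y + a * z);
     z, y + a * z, x - b * z + a * (y + a * z)] := by
  ext i j
  fin_cases i <;> fin_cases j <;>
    simp [pow_succ, Matrix.mul_apply, Matrix.algebraMap_matrix_apply] <;> ring

/-- The norm form of a cubic field is anisotropic. -/
lemma cubicNormForm_anisotropic {K : Type*} [Field K] {a b : K}
    (h : ∀ r, (unimodularCubic a b).eval r ≠ 0) {x y z : K}
    (h0 : cubicNormForm a b x y z = 0) : x = 0 ∧ y = 0 ∧ z = 0 := by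
  by_contra hne
  set q : K[X] := C x + C y * X + C z * X ^ 2 with hq
  have hq0 : q ≠ 0 := by
    intro hz
    apply hne
    refine ⟨?_, ?_, ?_⟩
    · simpa [hq] using congrArg (fun r => coeff r 0) hz
    · simpa [hq, coeff_X, coeff_C] using congrArg (fun r => coeff r 1) hz
    · simpa [hq, coeff_X, coeff_C] using congrArg (fun r => coeff r 2) hz
  have hdeg : q.natDegree ≤ 2 := by rw [hq]; compute_degree
  have hcop : IsCoprime (unimodularCubic a b) q := by
    refine (unimodularCubic_irreducible h).coprime_iff_not_dvd.2 fun hd => ?_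
    have := natDegree_le_of_dvd hd hq0
    rw [unimodularCubic_natDegree] at this
    omega
  obtain ⟨u, w, huw⟩ := hcop
  -- Evaluated at the companion matrix, the Bézout identity makes the matrix of `q` invertible.
  have := congrArg (aeval (!![0, 0, 1; 1, 0, -b; 0, 1, a] : Matrix (Fin 3) (Fin 3) K)) huw
  rw [map_add, map_mul, map_mul, aeval_unimodularCubic_companion, mul_zero, zero_add, map_one, hq,
    aeval_quadratic_companion] at this
  have hdet := congrArg Matrix.det this
  rw [Matrix.det_mul, Matrix.det_one] at hdet
  rw [cubicNormForm] at h0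
  rw [h0, mul_zero] at hdet
  exact zero_ne_one hdet

end NormForm

/-! ### Unramified cubic norms over ℚ_p -/

section Padic

/-- Some cubic `X³ - aX² + bX - 1` has no root in a given finite field, since such a cubic with a
root is determined by `a` and the root. -/
lemma exists_unimodularCubic_no_root (F : Type*) [Field F] [Finite F] :
    ∃ a b : F, ∀ r, (unimodularCubic a b).eval r ≠ 0 := by
  classical
  have := Fintype.ofFinite F
  by_contra! hcon
  let φ : F × Fˣ → F × F := fun s =>
    (s.1, (1 + s.1 * (s.2 : F) ^ 2 - (s.2 : F) ^ 3) / (s.2 : F))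
  have hφ : Function.Surjective φ := by
    rintro ⟨a, b⟩
    obtain ⟨r, hr⟩ := hcon a b
    simp only [unimodularCubic, eval_sub, eval_add, eval_mul, eval_pow, eval_X, eval_C,
      eval_one] at hr
    have hr0 : r ≠ 0 := by rintro rfl; simp at hr
    refine ⟨(a, Units.mk0 r hr0), ?_⟩
    simp only [φ, Units.val_mk0, Prod.mk.injEq, true_and]
    rw [div_eq_iff hr0]
    linear_combination -hr
  have h1 := Fintype.card_le_of_surjective φ hφ
  rw [Fintype.card_prod, Fintype.card_prod, Fintype.card_units] at h1
  have h2 : 0 < Fintype.card F := Fintype.card_pos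
  have := Nat.le_of_mul_le_mul_left h1 h2
  omega

variable {p : ℕ} [Fact p.Prime]

/-- A primitive vector stays nonzero mod p, where the form is anisotropic. -/
lemma padic_norm_cubicNormForm_eq_one {a b : ℤ}
    (h : ∀ r : ZMod p, (unimodularCubic (a : ZMod p) (b : ZMod p)).eval r ≠ 0) {x y z : ℤ_[p]}
    (hu : IsUnit x ∨ IsUnit y ∨ IsUnit z) :
    ‖cubicNormForm (a : ℤ_[p]) (b : ℤ_[p]) x y z‖ = 1 := by
  rw [← PadicInt.isUnit_iff]
  by_contra hnu
  have hmem : cubicNormForm (a : ℤ_[p]) (b : ℤ_[p]) x y z ∈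
      RingHom.ker (PadicInt.toZMod (p := p)) := by
    rw [PadicInt.ker_toZMod]; exact hnu
  rw [RingHom.mem_ker, cubicNormForm_map, map_intCast, map_intCast] at hmem
  obtain ⟨h1, h2, h3⟩ := cubicNormForm_anisotropic h hmem
  have key : ∀ t : ℤ_[p], PadicInt.toZMod t = 0 → ¬ IsUnit t := fun t ht htu =>
    (htu.map (PadicInt.toZMod (p := p))).ne_zero ht
  rcases hu with hu | hu | hu
  exacts [key _ h1 hu, key _ h2 hu, key _ h3 hu]

/-- The norm of an element of the unramified cubic extension is a cube up to a unit. -/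
lemma padic_norm_cubicNormForm {a b : ℤ}
    (h : ∀ r : ZMod p, (unimodularCubic (a : ZMod p) (b : ZMod p)).eval r ≠ 0) {x y z : ℚ_[p]}
    (hne : ¬ (x = 0 ∧ y = 0 ∧ z = 0)) :
    ∃ t : ℚ_[p], t ≠ 0 ∧ ‖cubicNormForm (a : ℚ_[p]) (b : ℚ_[p]) x y z‖ = ‖t‖ ^ 3 := by
  -- Dividing by a coordinate `t` of largest norm makes the vector integral and primitive.
  obtain ⟨t, ht, hx, hy, hz⟩ : ∃ t : ℚ_[p], (t = x ∨ t = y ∨ t = z) ∧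
      ‖x‖ ≤ ‖t‖ ∧ ‖y‖ ≤ ‖t‖ ∧ ‖z‖ ≤ ‖t‖ := by
    rcases le_total ‖x‖ ‖y‖ with h1 | h1 <;> rcases le_total ‖y‖ ‖z‖ with h2 | h2 <;>
      rcases le_total ‖x‖ ‖z‖ with h3 | h3
    · exact ⟨z, by simp, h3, h2, le_rfl⟩
    · exact ⟨z, by simp, h1.trans h2, h2, le_rfl⟩
    · exact ⟨y, by simp, h1, le_rfl, h2⟩
    · exact ⟨y, by simp, h1, le_rfl, h2⟩
    · exact ⟨z, by simp, h3, h2, le_rfl⟩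
    · exact ⟨x, by simp, le_rfl, h1, h3⟩
    · exact ⟨x, by simp, le_rfl, h1, h2.trans h1⟩
    · exact ⟨x, by simp, le_rfl, h1, h3⟩
  have ht0 : t ≠ 0 := by
    rintro rfl
    simp only [norm_zero, norm_le_zero_iff] at hx hy hz
    exact hne ⟨hx, hy, hz⟩
  have hdiv : ∀ u : ℚ_[p], ‖u‖ ≤ ‖t‖ → ∃ u' : ℤ_[p], (u' : ℚ_[p]) = u / t := fun u hu =>
    ⟨⟨u / t, by rw [norm_div]; exact div_le_one_of_le₀ hu (norm_nonneg _)⟩, rfl⟩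
  obtain ⟨x', hx'⟩ := hdiv x hx
  obtain ⟨y', hy'⟩ := hdiv y hy
  obtain ⟨z', hz'⟩ := hdiv z hz
  have hunit := padic_norm_cubicNormForm_eq_one h (x := x') (y := y') (z := z') (by
    simp only [PadicInt.isUnit_iff, PadicInt.norm_def, hx', hy', hz']
    rcases ht with rfl | rfl | rfl
    · left; rw [div_self ht0, norm_one]
    · right; left; rw [div_self ht0, norm_one]
    · right; right; rw [div_self ht0, norm_one])
  refine ⟨t, ht0, ?_⟩
  have hmap : ((cubicNormForm (a : ℤ_[p]) (b : ℤ_[p]) x' y' z' : ℤ_[p]) : ℚ_[p]) =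
      cubicNormForm (a : ℚ_[p]) (b : ℚ_[p]) (x / t) (y / t) (z / t) := by
    rw [← hx', ← hy', ← hz', ← PadicInt.coe_intCast, ← PadicInt.coe_intCast]
    exact cubicNormForm_map (PadicInt.Coe.ringHom (p := p)) _ _ _ _ _
  rw [PadicInt.norm_def, hmap] at hunit
  have := cubicNormForm_smul (a : ℚ_[p]) (b : ℚ_[p]) t (x / t) (y / t) (z / t)
  rw [mul_div_cancel₀ _ ht0, mul_div_cancel₀ _ ht0, mul_div_cancel₀ _ ht0] at this
  rw [this, norm_mul, norm_pow, hunit, mul_one]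

lemma padic_cubicNormForm_ne {a b : ℤ}
    (h : ∀ r : ZMod p, (unimodularCubic (a : ZMod p) (b : ZMod p)).eval r ≠ 0) (x y z : ℚ_[p]) :
    cubicNormForm (a : ℚ_[p]) (b : ℚ_[p]) x y z ≠ -(p : ℚ_[p]) ^ 2 := by
  intro heq
  have hp : (p : ℚ_[p]) ≠ 0 := by exact_mod_cast (Fact.out : p.Prime).ne_zero
  have hp1 : (1 : ℝ) < p := by exact_mod_cast (Fact.out : p.Prime).one_lt
  have hne : ¬ (x = 0 ∧ y = 0 ∧ z = 0) := by
    rintro ⟨rfl, rfl, rfl⟩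
    refine pow_ne_zero 2 hp (neg_eq_zero.1 (heq.symm.trans ?_))
    simp [cubicNormForm, Matrix.det_fin_three]
  obtain ⟨t, ht0, ht⟩ := padic_norm_cubicNormForm h hne
  rw [heq, norm_neg, norm_pow, Padic.norm_p, Padic.norm_eq_zpow_neg_valuation ht0,
    ← zpow_natCast, ← zpow_natCast, ← zpow_neg_one, ← zpow_mul, ← zpow_mul] at ht
  -- Comparing exponents of p: 2 is not a multiple of 3.
  have := zpow_right_injective₀ (by positivity) hp1.ne' ht
  push_cast at this
  omega

lemma padic_unimodularCubic_no_root {a b : ℤ}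
    (h : ∀ r : ZMod p, (unimodularCubic (a : ZMod p) (b : ZMod p)).eval r ≠ 0) (r : ℚ_[p]) :
    (unimodularCubic (a : ℚ_[p]) (b : ℚ_[p])).eval r ≠ 0 := by
  intro hr
  obtain ⟨t, ht0, ht⟩ := padic_norm_cubicNormForm h (x := -r) (y := 1) (z := 0) (by simp)
  rw [cubicNormForm_linear, hr, neg_zero, norm_zero] at ht
  exact pow_ne_zero 3 (norm_ne_zero_iff.2 ht0) ht.symm

end Padic

namespace SplitOctonion

/-! ### SL₃ inside G₂ -/

section SpecialLinear

variable {R : Type*} [CommRing R]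

lemma mulVec_cross_mulVec (M : Matrix (Fin 3) (Fin 3) R) (u v : Fin 3 → R) :
    (M *ᵥ u) ⨯₃ (M *ᵥ v) = M.adjugateᵀ *ᵥ (u ⨯₃ v) := by
  ext i
  fin_cases i <;>
    simp [cross_apply, Matrix.mulVec, dotProduct, Fin.sum_univ_three, Matrix.adjugate_fin_three] <;>
    ring

lemma adjugate_transpose_adjugate_transpose (M : Matrix (Fin 3) (Fin 3) R) (hM : M.det = 1) :
    M.adjugateᵀ.adjugateᵀ = M := by
  rw [Matrix.adjugate_transpose, Matrix.transpose_transpose, Matrix.adjugate_adjugate M (by simp)]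
  simp [hM]

lemma mulVec_dotProduct_adjugate (M : Matrix (Fin 3) (Fin 3) R) (hM : M.det = 1)
    (u v : Fin 3 → R) : (M *ᵥ u) ⬝ᵥ (M.adjugateᵀ *ᵥ v) = u ⬝ᵥ v := by
  rw [Matrix.mulVec_transpose, dotProduct_comm, ← Matrix.dotProduct_mulVec, Matrix.mulVec_mulVec,
    Matrix.adjugate_mul, hM, one_smul, Matrix.one_mulVec, dotProduct_comm]

/-- A unimodular matrix `M` acts on the split octonions by `M` on `v` and by its inverse transpose
on `w`. -/
def ofMatrix (M : Matrix (Fin 3) (Fin 3) R) (hM : M.det = 1) :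
    SplitOctonion R ≃ₗ[R] SplitOctonion R where
  toFun x := ⟨x.α, M *ᵥ x.v, M.adjugateᵀ *ᵥ x.w, x.β⟩
  invFun x := ⟨x.α, M.adjugate *ᵥ x.v, Mᵀ *ᵥ x.w, x.β⟩
  map_add' x y := by ext <;> simp [Matrix.mulVec_add]
  map_smul' c x := by ext <;> simp [Matrix.mulVec_smul]
  left_inv x := by
    ext i
    · rfl
    · simp [Matrix.mulVec_mulVec, Matrix.adjugate_mul, hM]
    · simp [Matrix.mulVec_mulVec, ← Matrix.transpose_mul, Matrix.adjugate_mul, hM]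
    · rfl
  right_inv x := by
    ext i
    · rfl
    · simp [Matrix.mulVec_mulVec, Matrix.mul_adjugate, hM]
    · simp [Matrix.mulVec_mulVec, ← Matrix.transpose_mul, Matrix.mul_adjugate, hM]
    · rfl

lemma ofMatrix_apply (M : Matrix (Fin 3) (Fin 3) R) (hM : M.det = 1) (x : SplitOctonion R) :
    ofMatrix M hM x = ⟨x.α, M *ᵥ x.v, M.adjugateᵀ *ᵥ x.w, x.β⟩ := rfl

lemma ofMatrix_mem (M : Matrix (Fin 3) (Fin 3) R) (hM : M.det = 1) :
    ofMatrix M hM ∈ SplitG2 R := by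
  intro x y
  have h2 := mulVec_cross_mulVec M.adjugateᵀ x.w y.w
  rw [adjugate_transpose_adjugate_transpose M hM] at h2
  ext1
  · simp [ofMatrix_apply, mulVec_dotProduct_adjugate M hM]
  · simp [ofMatrix_apply, h2, Matrix.mulVec_add, Matrix.mulVec_smul]
  · simp [ofMatrix_apply, mulVec_cross_mulVec, Matrix.mulVec_add, Matrix.mulVec_smul]
  · simp [ofMatrix_apply, dotProduct_comm _ (M *ᵥ _), dotProduct_comm _ y.v,
      mulVec_dotProduct_adjugate M hM]

lemma aeval_ofMatrix_apply (M : Matrix (Fin 3) (Fin 3) R) (hM : M.det = 1) (q : R[X])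
    (x : SplitOctonion R) :
    aeval (ofMatrix M hM : Module.End R (SplitOctonion R)) q x =
      ⟨q.eval 1 * x.α, aeval M q *ᵥ x.v, aeval M.adjugateᵀ q *ᵥ x.w, q.eval 1 * x.β⟩ := by
  induction q using Polynomial.induction_on' with
  | add q r hq hr =>
    rw [map_add, LinearMap.add_apply, hq, hr]
    ext <;> simp [add_mul, Matrix.add_mulVec]
  | monomial n c =>
    rw [aeval_monomial, aeval_monomial, aeval_monomial]
    simp only [eval_monomial, one_pow, mul_one, ← Algebra.smul_def, LinearMap.smul_apply,
      Matrix.smul_mulVec]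
    induction n generalizing c with
    | zero => ext <;> simp
    | succ n ih =>
      have := ih 1
      simp only [one_smul, one_mul] at this
      rw [pow_succ', Module.End.mul_apply, this]
      ext <;> simp [ofMatrix_apply, pow_succ', Matrix.mulVec_mulVec]

end SpecialLinear

/-! ### Semisimplicity and the obstruction to reality -/

section Field

variable {k : Type*} [Field k]

/-- Swapping `a` and `b` gives, up to sign, the reciprocal polynomial, whose roots are the inverses.
-/
lemma unimodularCubic_swap_no_root {a b : k} (h : ∀ r, (unimodularCubic a b).eval r ≠ 0) (r : k) :
    (unimodularCubic b a).eval r ≠ 0 := by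
  intro hr
  have h1 := h r⁻¹
  simp only [unimodularCubic, eval_sub, eval_add, eval_mul, eval_pow, eval_X, eval_C,
    eval_one] at hr h1
  have hr0 : r ≠ 0 := by rintro rfl; simp at hr
  apply h1
  field_simp
  linear_combination -hr

lemma ne_of_unimodularCubic_no_root {a b : k} (h : ∀ r, (unimodularCubic a b).eval r ≠ 0) :
    a ≠ b := by
  rintro rfl
  exact h 1 (by simp [unimodularCubic])

/-- Three irreducible factors, separable in characteristic 0 and pairwise coprime because `a ≠ b`.
They account for the action on the diagonal, on `v` and on `w`. -/
lemma separable_cubics [CharZero k] {a b : k} (h : ∀ r, (unimodularCubic a b).eval r ≠ 0) :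
    ((X - C 1) * (unimodularCubic a b * unimodularCubic b a)).Separable := by
  have h' := unimodularCubic_swap_no_root h
  have hi := unimodularCubic_irreducible h
  have hi' := unimodularCubic_irreducible h'
  have hX : ∀ q : k[X], q.eval 1 ≠ 0 → IsCoprime (X - C 1) q := fun q hq =>
    (irreducible_X_sub_C (1 : k)).coprime_iff_not_dvd.2 fun hd => hq (dvd_iff_isRoot.1 hd)
  refine (separable_X_sub_C).mul (hi.separable.mul hi'.separable ?_)
    ((hX _ (h 1)).mul_right (hX _ (h' 1)))
  refine hi.coprime_iff_not_dvd.2 fun hd => ne_of_unimodularCubic_no_root h ?_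
  have := eq_of_monic_of_dvd_of_natDegree_le (unimodularCubic_monic a b)
    (unimodularCubic_monic b a) hd (by simp [unimodularCubic_natDegree])
  have := congrArg (fun q => coeff q 2) this
  simpa [unimodularCubic, coeff_X, coeff_one] using this.symm

lemma ofMatrix_isSemisimple [CharZero k] {a b : k} (h : ∀ r, (unimodularCubic a b).eval r ≠ 0)
    (M : Matrix (Fin 3) (Fin 3) k) (hM : M.det = 1) (h1 : aeval M (unimodularCubic a b) = 0)
    (h2 : aeval M.adjugateᵀ (unimodularCubic b a) = 0) :
    SplitG2.IsSemisimple (⟨ofMatrix M hM, ofMatrix_mem M hM⟩ : SplitG2 k) := by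
  refine (separable_cubics h).of_dvd (minpoly.dvd _ _ ?_)
  ext1 x
  change aeval (ofMatrix M hM : Module.End k (SplitOctonion k)) _ x = 0
  rw [aeval_ofMatrix_apply, map_mul, map_mul, map_mul, map_mul, h1, h2]
  ext <;> simp

/-- A conjugator of `ofMatrix M` to its inverse, where `M` has no nonzero fixed vector on `v` or
`w`, either conjugates `M` to its inverse or provides a unimodular matrix conjugating `M` to its
transpose. -/
lemma exists_matrix_of_isRealElement (M : Matrix (Fin 3) (Fin 3) k) (hM : M.det = 1)
    (hv : ∀ u, M *ᵥ u = u → u = 0) (hw : ∀ u, M.adjugateᵀ *ᵥ u = u → u = 0)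
    (hr : IsRealElement (⟨ofMatrix M hM, ofMatrix_mem M hM⟩ : SplitG2 k)) :
    (∃ B : Matrix (Fin 3) (Fin 3) k, B.det ≠ 0 ∧ M * B * M = B) ∨
    (∃ B : Matrix (Fin 3) (Fin 3) k, B.det = 1 ∧ B * M = Mᵀ * B) := by
  obtain ⟨c, hc⟩ := isConj_iff.1 hr
  obtain ⟨h, hmul⟩ := c
  -- The relation c g c⁻¹ = g⁻¹ in the form g c g = c; applied to the fixed vector `e`, it shows
  -- that `h e` is fixed by g.
  have hcomm : ∀ x, ofMatrix M hM (h (ofMatrix M hM x)) = h x := by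
    intro x
    have h1 := mul_inv_eq_iff_eq_mul.1 hc
    rw [← mul_right_inj (⟨ofMatrix M hM, ofMatrix_mem M hM⟩ : SplitG2 k), mul_inv_cancel_left] at h1
    exact congrArg (fun s : SplitG2 k => (s : SplitOctonion k ≃ₗ[k] SplitOctonion k) x) h1
  replace hmul : ∀ x y, h (x * y) = h x * h y := hmul
  set e : SplitOctonion k := ⟨1, 0, 0, 0⟩
  set e' : SplitOctonion k := ⟨0, 0, 0, 1⟩
  have hee' : e * e' = 0 := by ext <;> simp [e, e']
  have hee : e * e = e := by ext <;> simp [e]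
  have he0 : e ≠ 0 := fun h0 => one_ne_zero (congrArg SplitOctonion.α h0)
  have he0' : e' ≠ 0 := fun h0 => one_ne_zero (congrArg SplitOctonion.β h0)
  have hfix := hcomm e
  rw [show ofMatrix M hM e = e by rw [ofMatrix_apply]; ext <;> simp [e], ofMatrix_apply] at hfix
  have hev : (h e).v = 0 := hv _ (congrArg SplitOctonion.v hfix)
  have hew : (h e).w = 0 := hw _ (congrArg SplitOctonion.w hfix)
  have hid := hmul e e
  rw [hee] at hid
  have hα : (h e).α = 0 ∨ (h e).α = 1 := by
    have := congrArg SplitOctonion.α hid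
    rw [mul_α, hev, zero_dotProduct, sub_zero] at this
    rcases eq_or_ne (h e).α 0 with h0 | h0
    · exact Or.inl h0
    · exact Or.inr (mul_left_cancel₀ h0 (by rw [← this, mul_one]))
  have hβ : (h e).β = 0 ∨ (h e).β = 1 := by
    have := congrArg SplitOctonion.β hid
    rw [mul_β, hew, zero_dotProduct, sub_zero] at this
    rcases eq_or_ne (h e).β 0 with h0 | h0
    · exact Or.inl h0
    · exact Or.inr (mul_left_cancel₀ h0 (by rw [← this, mul_one]))
  have hcase : h e = e ∨ h e = e' := by
    rcases hα with h1 | h1 <;> rcases hβ with h2 | h2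
    · exact absurd ((LinearEquiv.map_eq_zero_iff h).1
        (SplitOctonion.ext h1 hev hew h2 : h e = 0)) he0
    · exact Or.inr (SplitOctonion.ext h1 hev hew h2)
    · exact Or.inl (SplitOctonion.ext h1 hev hew h2)
    · have h3 : h e = 1 := SplitOctonion.ext h1 hev hew h2
      have h4 := hmul e e'
      rw [hee', h3, one_mul, map_zero] at h4
      exact absurd ((LinearEquiv.map_eq_zero_iff h).1 h4.symm) he0'
  let ιv : (Fin 3 → k) →ₗ[k] SplitOctonion k :=
    { toFun := fun u => ⟨0, u, 0, 0⟩
      map_add' := fun _ _ => by ext <;> simp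
      map_smul' := fun _ _ => by ext <;> simp }
  let πv : SplitOctonion k →ₗ[k] (Fin 3 → k) :=
    { toFun := SplitOctonion.v
      map_add' := fun _ _ => rfl
      map_smul' := fun _ _ => rfl }
  let πw : SplitOctonion k →ₗ[k] (Fin 3 → k) :=
    { toFun := SplitOctonion.w
      map_add' := fun _ _ => rfl
      map_smul' := fun _ _ => rfl }
  have hle : ∀ u : Fin 3 → k, e * ⟨0, u, 0, 0⟩ = ⟨0, u, 0, 0⟩ := fun u => by ext <;> simp [e]
  have hre : ∀ u : Fin 3 → k, (⟨0, u, 0, 0⟩ : SplitOctonion k) * e = 0 := fun u => by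
    ext <;> simp [e]
  have hle' : ∀ u : Fin 3 → k, e * ⟨0, 0, u, 0⟩ = 0 := fun u => by ext <;> simp [e]
  have hre' : ∀ u : Fin 3 → k, (⟨0, 0, u, 0⟩ : SplitOctonion k) * e = ⟨0, 0, u, 0⟩ := fun u => by
    ext <;> simp [e]
  rcases hcase with hcase | hcase
  · left
    -- The `v`-part is the Peirce space {x : e x = x, x e = 0}, which `h` preserves when it fixes
    -- `e`.
    have hform : ∀ u, h ⟨0, u, 0, 0⟩ = ⟨0, (h ⟨0, u, 0, 0⟩).v, 0, 0⟩ := fun u => by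
      have h1 := hmul e ⟨0, u, 0, 0⟩
      have h2 := hmul ⟨0, u, 0, 0⟩ e
      rw [hcase, hle] at h1
      rw [hcase, hre, map_zero] at h2
      ext1
      · simpa [e] using (congrArg SplitOctonion.α h2).symm
      · rfl
      · simpa [e] using congrArg SplitOctonion.w h1
      · simpa [e] using congrArg SplitOctonion.β h1
    set B : Matrix (Fin 3) (Fin 3) k := LinearMap.toMatrix' (πv ∘ₗ h.toLinearMap ∘ₗ ιv)
    have hBv : ∀ u, B *ᵥ u = (h ⟨0, u, 0, 0⟩).v := fun u => LinearMap.toMatrix'_mulVec _ _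
    refine ⟨B, ?_, ?_⟩
    · intro hdet
      obtain ⟨u, hu0, hu⟩ := Matrix.exists_mulVec_eq_zero_iff.2 hdet
      rw [hBv] at hu
      have := hform u
      rw [hu] at this
      have := (LinearEquiv.map_eq_zero_iff h).1 (this : h _ = 0)
      exact hu0 (congrArg SplitOctonion.v this)
    · refine Matrix.ext_of_mulVec_single fun i => ?_
      have := congrArg SplitOctonion.v (hcomm ⟨0, Pi.single i 1, 0, 0⟩)
      rw [ofMatrix_apply, ofMatrix_apply] at this
      simp only [Matrix.mulVec_zero] at this
      rwa [← hBv, ← hBv, Matrix.mulVec_mulVec, Matrix.mulVec_mulVec] at this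
  · right
    -- With `e` sent to `e'`, the Peirce spaces `v` and `w` are exchanged.
    have hform : ∀ u, h ⟨0, u, 0, 0⟩ = ⟨0, 0, (h ⟨0, u, 0, 0⟩).w, 0⟩ := fun u => by
      have h1 := hmul e ⟨0, u, 0, 0⟩
      have h2 := hmul ⟨0, u, 0, 0⟩ e
      rw [hcase, hle] at h1
      rw [hcase, hre, map_zero] at h2
      ext1
      · simpa [e'] using congrArg SplitOctonion.α h1
      · simpa [e'] using congrArg SplitOctonion.v h1
      · rfl
      · simpa [e'] using (congrArg SplitOctonion.β h2).symm
    have hform' : ∀ u, h ⟨0, 0, u, 0⟩ = ⟨0, (h ⟨0, 0, u, 0⟩).v, 0, 0⟩ := fun u => by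
      have h1 := hmul e ⟨0, 0, u, 0⟩
      have h2 := hmul ⟨0, 0, u, 0⟩ e
      rw [hcase, hle', map_zero] at h1
      rw [hcase, hre'] at h2
      ext1
      · simpa [e'] using congrArg SplitOctonion.α h2
      · rfl
      · simpa [e'] using congrArg SplitOctonion.w h2
      · simpa [e'] using (congrArg SplitOctonion.β h1).symm
    set B : Matrix (Fin 3) (Fin 3) k := LinearMap.toMatrix' (πw ∘ₗ h.toLinearMap ∘ₗ ιv)
    have hBv : ∀ u, B *ᵥ u = (h ⟨0, u, 0, 0⟩).w := fun u => LinearMap.toMatrix'_mulVec _ _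
    have hcross : ∀ u u', (h ⟨0, 0, u ⨯₃ u', 0⟩).v = (B *ᵥ u) ⨯₃ (B *ᵥ u') := fun u u' => by
      have h1 := hmul ⟨0, u, 0, 0⟩ ⟨0, u', 0, 0⟩
      rw [show (⟨0, u, 0, 0⟩ : SplitOctonion k) * ⟨0, u', 0, 0⟩ = ⟨0, 0, u ⨯₃ u', 0⟩ by
        ext <;> simp, hform u, hform u', ← hBv, ← hBv] at h1
      simpa using congrArg SplitOctonion.v h1
    have hdot : ∀ u u', (B *ᵥ u) ⬝ᵥ (h ⟨0, 0, u', 0⟩).v = u ⬝ᵥ u' := fun u u' => by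
      have h1 := hmul ⟨0, u, 0, 0⟩ ⟨0, 0, u', 0⟩
      rw [show (⟨0, u, 0, 0⟩ : SplitOctonion k) * ⟨0, 0, u', 0⟩ = (-(u ⬝ᵥ u')) • e by
        ext <;> simp [e], map_smul, hcase, hform u, hform' u', ← hBv] at h1
      simpa [e'] using (congrArg SplitOctonion.β h1).symm
    refine ⟨B, ?_, ?_⟩
    · have h1 := hdot (Pi.single 2 1) (Pi.single 0 1 ⨯₃ Pi.single 1 1)
      rw [hcross] at h1
      simp [cross_apply, dotProduct, Fin.sum_univ_three, Matrix.mulVec_single] at h1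
      rw [Matrix.det_fin_three]
      linear_combination h1
    · refine Matrix.ext_of_mulVec_single fun i => ?_
      have := congrArg SplitOctonion.w (hcomm ⟨0, Pi.single i 1, 0, 0⟩)
      rw [ofMatrix_apply, ofMatrix_apply] at this
      simp only [Matrix.mulVec_zero] at this
      rw [← hBv, ← hBv, Matrix.mulVec_mulVec] at this
      have h2 := congrArg (Mᵀ *ᵥ ·) this
      simp only [Matrix.mulVec_mulVec, ← mul_assoc, ← Matrix.transpose_mul, Matrix.adjugate_mul,
        hM, one_smul, Matrix.transpose_one, one_mul] at h2
      exact h2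

/-- The companion matrix of `unimodularCubic a b`, conjugated by `diag(d, 1, 1)`. -/
def twistedCompanion (a b d : k) : Matrix (Fin 3) (Fin 3) k :=
  !![0, 0, d; d⁻¹, 0, -b; 0, 1, a]

lemma twistedCompanion_det (a b : k) {d : k} (hd : d ≠ 0) : (twistedCompanion a b d).det = 1 := by
  simp [twistedCompanion, Matrix.det_fin_three, hd]

lemma aeval_twistedCompanion (a b : k) {d : k} (hd : d ≠ 0) :
    aeval (twistedCompanion a b d) (unimodularCubic a b) = 0 := by
  ext i j
  fin_cases i <;> fin_cases j <;>
    simp [twistedCompanion, unimodularCubic, pow_succ, Matrix.mul_apply,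
      Matrix.algebraMap_matrix_apply] <;> field_simp <;> ring

lemma twistedCompanion_adjugate_transpose (a b : k) {d : k} (hd : d ≠ 0) :
    (twistedCompanion a b d).adjugateᵀ = !![b, -(a * d⁻¹), d⁻¹; d, 0, 0; 0, 1, 0] := by
  ext i j
  fin_cases i <;> fin_cases j <;>
    simp [twistedCompanion, Matrix.adjugate_fin_three, hd, mul_comm a]

lemma aeval_twistedCompanion_adjugate_transpose (a b : k) {d : k} (hd : d ≠ 0) :
    aeval (twistedCompanion a b d).adjugateᵀ (unimodularCubic b a) = 0 := by
  rw [twistedCompanion_adjugate_transpose a b hd]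
  ext i j
  fin_cases i <;> fin_cases j <;>
    simp [unimodularCubic, pow_succ, Matrix.mul_apply,
      Matrix.algebraMap_matrix_apply] <;> field_simp <;> ring

/-- On a fixed vector, q(M) acts as the scalar q(1). -/
lemma eq_zero_of_mulVec_eq_self {q : k[X]} (hq : q.eval 1 ≠ 0) {M : Matrix (Fin 3) (Fin 3) k}
    (hM : aeval M q = 0) (u : Fin 3 → k) (hu : M *ᵥ u = u) : u = 0 := by
  obtain ⟨r, hr⟩ := X_sub_C_dvd_sub_C_eval (a := (1 : k)) (p := q)
  have h1 := congrArg (aeval M) ((sub_eq_iff_eq_add.1 hr).trans (by rw [mul_comm]))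
  rw [hM, map_add, map_mul] at h1
  have h2 := congrArg (· *ᵥ u) h1
  simp [Matrix.add_mulVec, ← Matrix.mulVec_mulVec, Matrix.sub_mulVec, hu,
    Algebra.algebraMap_eq_smul_one, Matrix.smul_mulVec] at h2
  exact (smul_eq_zero.1 h2.symm).resolve_left hq

theorem twistedCompanion_not_real {a b d : k} (hd : d ≠ 0)
    (h : ∀ r, (unimodularCubic a b).eval r ≠ 0)
    (hN : ∀ x y z, cubicNormForm a b x y z ≠ -d ^ 2) :
    ¬ IsRealElement (⟨ofMatrix _ (twistedCompanion_det a b hd), ofMatrix_mem _ _⟩ : SplitG2 k) := by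
  intro hr
  rcases exists_matrix_of_isRealElement _ _
    (eq_zero_of_mulVec_eq_self (h 1) (aeval_twistedCompanion a b hd))
    (eq_zero_of_mulVec_eq_self (unimodularCubic_swap_no_root h 1)
      (aeval_twistedCompanion_adjugate_transpose a b hd)) hr with ⟨B, hB, hBM⟩ | ⟨B, hB, hBM⟩
  · apply ne_of_unimodularCubic_no_root h
    have hu : IsUnit B.det := hB.isUnit
    have h1 : B * twistedCompanion a b d * B⁻¹ = (twistedCompanion a b d).adjugate := by
      have h2 := congrArg (fun T => (twistedCompanion a b d).adjugate * T * B⁻¹) hBM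
      simp only [← mul_assoc, Matrix.adjugate_mul, twistedCompanion_det a b hd, one_smul,
        one_mul] at h2
      rw [h2, Matrix.mul_nonsing_inv_cancel_right _ _ hu]
    have h2 := congrArg Matrix.trace h1
    rw [Matrix.trace_mul_comm, ← mul_assoc, Matrix.nonsing_inv_mul _ hu, one_mul,
      ← Matrix.trace_transpose (Matrix.adjugate _), twistedCompanion_adjugate_transpose a b hd] at h2
    simpa [twistedCompanion, Matrix.trace_fin_three] using h2
  · have hent := fun i j => congrFun (congrFun hBM i) j
    have h00 := hent 0 0
    have h01 := hent 0 1
    have h02 := hent 0 2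
    have h10 := hent 1 0
    have h12 := hent 1 2
    have h20 := hent 2 0
    simp only [twistedCompanion, Matrix.mul_apply, Fin.sum_univ_three, Matrix.transpose_apply,
      Matrix.of_apply, Matrix.cons_val', Matrix.cons_val_zero, Matrix.cons_val_one,
      Matrix.cons_val, Matrix.cons_val_fin_one, mul_zero, zero_mul, zero_add, add_zero, mul_one,
      one_mul] at h00 h01 h02 h10 h12 h20
    -- With D = diag(d, 1, 1), the matrix D B D intertwines the untwisted companion matrix with its
    -- transpose, hence is Hankel; the first row of `B` determines the rest.
    have e10 : B 1 0 = B 0 1 := by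
      field_simp at h00
      exact h00.symm
    have e11 : B 1 1 = d * B 0 2 := by rw [h01]; field_simp
    have e20 : B 2 0 = B 0 2 := by rw [← h10, h01, mul_comm]
    have e12 : B 1 2 = d * (d * B 0 0 - b * B 0 1 + a * B 0 2) := by
      field_simp at h02
      linear_combination -h02
    have e21 : B 2 1 = d * (d * B 0 0 - b * B 0 1 + a * B 0 2) := by
      field_simp at h20
      rw [h20, e10, e20]
      ring
    have e22 : B 2 2 = d * B 0 1 - b * B 1 1 + a * B 1 2 := by
      rw [← h12, e10]
      ring
    rw [Matrix.det_fin_three, e22, e21, e12, e11, e20, e10] at hB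
    -- Let s₀ = d² B₀₀, s₁ = d B₀₁, s₂ = d B₀₂ be the first row of D B D. The witness is the c in K
    -- for which sᵢ is the t²-coefficient of c tⁱ. The Hankel matrix for c = 1 has determinant -1,
    -- so N(c) = -det(D B D) = -d² det B.
    apply hN (d * B 0 2 - a * (d * B 0 1) + b * (d ^ 2 * B 0 0)) (d * B 0 1 - a * (d ^ 2 * B 0 0))
      (d ^ 2 * B 0 0)
    rw [cubicNormForm, Matrix.det_fin_three]
    simp only [Matrix.of_apply, Matrix.cons_val', Matrix.cons_val_zero, Matrix.cons_val_one,
      Matrix.cons_val, Matrix.cons_val_fin_one]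
    linear_combination (-d ^ 2) * hB

theorem exists_semisimple_not_real [CharZero k] {a b d : k} (hd : d ≠ 0)
    (h : ∀ r, (unimodularCubic a b).eval r ≠ 0)
    (hN : ∀ x y z, cubicNormForm a b x y z ≠ -d ^ 2) :
    ∃ g : SplitG2 k, SplitG2.IsSemisimple g ∧ ¬ IsRealElement g :=
  ⟨_, ofMatrix_isSemisimple h _ _ (aeval_twistedCompanion a b hd)
    (aeval_twistedCompanion_adjugate_transpose a b hd), twistedCompanion_not_real hd h hN⟩

end Field

/-- A root of the cubic, or a representation of -p² by its norm form, would be carried by `φ` into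
ℚ_p. -/
theorem exists_semisimple_not_real_of_padic_embedding {k : Type*} [Field k] [CharZero k] (p : ℕ)
    [Fact p.Prime] (φ : k →+* ℚ_[p]) :
    ∃ g : SplitG2 k, SplitG2.IsSemisimple g ∧ ¬ IsRealElement g := by
  obtain ⟨a, b, hab⟩ := exists_unimodularCubic_no_root (ZMod p)
  obtain ⟨a, rfl⟩ := ZMod.intCast_surjective a
  obtain ⟨b, rfl⟩ := ZMod.intCast_surjective b
  refine exists_semisimple_not_real (a := (a : k)) (b := (b : k)) (d := (p : k))
    (by exact_mod_cast (Fact.out : p.Prime).ne_zero) (fun r hr => ?_) (fun x y z hN => ?_)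
  · apply padic_unimodularCubic_no_root hab (φ r)
    have := congrArg φ hr
    simpa [unimodularCubic] using this
  · apply padic_cubicNormForm_ne hab (φ x) (φ y) (φ z)
    have := congrArg φ hN
    rw [cubicNormForm_map] at this
    simpa using this

end SplitOctonion

theorem theorem6p19 :
    (∃ g : SplitG2 ℚ, SplitG2.IsSemisimple g ∧ ¬ IsRealElement g) ∧
    (∀ (p : ℕ) [Fact p.Prime],
      ∃ g : SplitG2 ℚ_[p], SplitG2.IsSemisimple g ∧ ¬ IsRealElement g) :=
  ⟨SplitOctonion.exists_semisimple_not_real_of_padic_embedding 2 (algebraMap ℚ ℚ_[2]),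
    fun p _ => SplitOctonion.exists_semisimple_not_real_of_padic_embedding p (RingHom.id _)⟩
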